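/- Let $(W,S)$ be a Coxeter system. A \emph{reflection} of $W$ is an element of $W$ that is conjugate to an element of $S$, and a \emph{reflection subgroup} of $W$ is a subgroup of $W$ generated by a set of reflections. Let $J=\{s_1,\dots,s_n\}\subseteq S$ be a finite subset with $s_1,\dots,s_n$ pairwise distinct, listed in an arbitrary order, let $w=s_1s_2\cdots s_n$, and let $W_J=\langle J\rangle$. Then every reflection subgroup of $W$ that contains $w$ also contains $J$. In particular, $W_J$ is the unique minimal (with respect to inclusion) reflection subgroup of $W$ containing $w$. -/

import Mathlib

namespace CoxeterSystem

/-- A subgroup of `W` is a reflection subgroup if it is generated by some set of reflections,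
a reflection being a conjugate of a simple generator. -/
def IsReflectionSubgroup {B W : Type*} [Group W] {M : CoxeterMatrix B} (cs : CoxeterSystem M W)
    (G : Subgroup W) : Prop :=
  ∃ T : Set W, (∀ t ∈ T, cs.IsReflection t) ∧ G = Subgroup.closure T

end CoxeterSystem

/-!
For a word `ω = (s₁, …, sₙ)`, let `N(ω)` be the set of reflections `t` that occur an odd number of
times among the elements `s₁ ⋯ sₖ₋₁ sₖ sₖ₋₁ ⋯ s₁`. It depends only on `w = s₁ ⋯ sₙ`, because
`w ↦ (N(w), w)` is a homomorphism into the semidirect product of the sign functions on `W` by `W`.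
If `t ∈ N(w)`, then `t w` is obtained from `s₁ ⋯ sₙ` by omitting a factor (strong exchange).

Following Dyer, a reflection subgroup `G` is generated by the reflections `r` with
`N(r) ∩ G = {r}`, and exchange holds for words in these generators and reflections in `G`; hence
every `w ≠ 1` in `G` has an inversion `t ∈ G`. If moreover `w` is a product of distinct simple
reflections, then `t w ∈ G` is the product of all of them but one, so by induction `G` contains the
remaining factors and therefore also the omitted one.
-/

section SignedReflection

variable {W : Type*} [Group W]

/-- The action of a group on its sign functions induced by conjugation. A sign function `W → ℤˣ`
encodes the set on which it takes the value `-1`, so that multiplication is symmetric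
difference. -/
def conjSignAction (W : Type*) [Group W] : W →* MulAut (W → ℤˣ) :=
  (mulAutArrow (G := ConjAct W) (A := W) (M := ℤˣ)).comp ConjAct.toConjAct.toMonoidHom

theorem conjSignAction_apply (x : W) (f : W → ℤˣ) (t : W) :
    conjSignAction W x f t = f (x⁻¹ * t * x) := by
  change f ((ConjAct.toConjAct x)⁻¹ • t) = _
  rw [← ConjAct.toConjAct_inv, ConjAct.toConjAct_smul, inv_inv]

variable [DecidableEq W]

theorem conjSignAction_mulSingle (x r : W) (ε : ℤˣ) :
    conjSignAction W x (Pi.mulSingle r ε) = Pi.mulSingle (x * r * x⁻¹) ε := by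
  funext t
  rw [conjSignAction_apply, Pi.mulSingle_apply, Pi.mulSingle_apply]
  congr 1
  rw [eq_mul_inv_iff_mul_eq, mul_assoc, inv_mul_eq_iff_eq_mul]

/-- The element `r` of a group together with the sign function of `{r}`. Products of such pairs
track, besides the product of a word of involutions, the parities in its left inversion
sequence. -/
def signedReflection (r : W) : (W → ℤˣ) ⋊[conjSignAction W] W :=
  ⟨Pi.mulSingle r (-1), r⟩

theorem signedReflection_mul_pow {a b : W} (ha : a * a = 1) (hb : b * b = 1) (n : ℕ) :
    (signedReflection a * signedReflection b) ^ n =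
      ⟨∏ k ∈ Finset.range (2 * n), Pi.mulSingle ((a * b) ^ k * a) (-1), (a * b) ^ n⟩ := by
  have ha' : a⁻¹ = a := inv_eq_of_mul_eq_one_left ha
  have hb' : b⁻¹ = b := inv_eq_of_mul_eq_one_left hb
  have hinv : SemiconjBy a (a * b)⁻¹ (a * b) := by
    simp only [SemiconjBy, mul_inv_rev, ha', hb', mul_assoc]
  have hpow (n : ℕ) : a * ((a * b) ^ n)⁻¹ = (a * b) ^ n * a := by
    simpa only [inv_pow] using (hinv.pow_right n).eq
  induction n with
  | zero => ext1 <;> simp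
  | succ n ih =>
    have hconj_a : (a * b) ^ n * a * ((a * b) ^ n)⁻¹ = (a * b) ^ (2 * n) * a := by
      rw [mul_assoc, hpow, two_mul, pow_add, mul_assoc]
    have hconj_b : (a * b) ^ n * (a * b * a⁻¹) * ((a * b) ^ n)⁻¹ = (a * b) ^ (2 * n + 1) * a := by
      rw [ha', mul_assoc, mul_assoc _ a, hpow, ← mul_assoc, ← pow_succ, ← mul_assoc, ← pow_add]
      congr 2
      ring
    rw [pow_succ, ih, mul_add_one, Finset.prod_range_succ, Finset.prod_range_succ, ← hconj_a,
      ← hconj_b, mul_assoc]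
    ext1
    · simp only [signedReflection, SemidirectProduct.mul_left, map_mul, conjSignAction_mulSingle]
    · simp only [signedReflection, SemidirectProduct.mul_right, pow_succ]

theorem isLiftable_signedReflection {B : Type*} {M : CoxeterMatrix B} (cs : CoxeterSystem M W) :
    M.IsLiftable fun i ↦ signedReflection (cs.simple i) := by
  intro i j
  rw [signedReflection_mul_pow (cs.simple_mul_simple_self i) (cs.simple_mul_simple_self j), two_mul,
    Finset.prod_range_add]
  simp only [pow_add, cs.simple_mul_simple_pow, one_mul]
  ext1
  · funext t
    exact Int.units_mul_self _
  · rfl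

end SignedReflection

section InversionSet

variable {B W : Type*} [Group W] {M : CoxeterMatrix B} (cs : CoxeterSystem M W)

open scoped Classical in
/-- The homomorphism `w ↦ (N(w), w)` extending `s ↦ ({s}, s)` on simple reflections. -/
noncomputable def signedLift : W →* (W → ℤˣ) ⋊[conjSignAction W] W :=
  cs.lift ⟨_, isLiftable_signedReflection cs⟩

theorem signedLift_right (w : W) : (signedLift cs w).right = w :=
  have h : SemidirectProduct.rightHom.comp (signedLift cs) = MonoidHom.id W :=
    cs.ext_simple fun i ↦ by
      simp only [signedLift, MonoidHom.comp_apply, cs.lift_apply_simple, MonoidHom.id_apply]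
      rfl
  DFunLike.congr_fun h w

/-- The set `N(w)` of left inversions of `w`, in the form in which it satisfies a cocycle identity:
`t ∈ N(w)` if `t` occurs an odd number of times in the left inversion sequence of any word
for `w`. -/
def inversionSet (w : W) : Set W :=
  {t | (signedLift cs w).left t = -1}

theorem inversionSet_one : inversionSet cs 1 = ∅ := by
  ext t
  simp [inversionSet]

theorem inversionSet_simple (i : B) : inversionSet cs (cs.simple i) = {cs.simple i} := by
  ext t
  simp [inversionSet, signedLift, signedReflection, cs.lift_apply_simple, Pi.mulSingle_apply]

theorem mem_inversionSet_mul {x y t : W} :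
    t ∈ inversionSet cs (x * y) ↔
      Xor (t ∈ inversionSet cs x) (x⁻¹ * t * x ∈ inversionSet cs y) := by
  simp only [inversionSet, Set.mem_ofPred_eq, map_mul, SemidirectProduct.mul_left, Pi.mul_apply,
    signedLift_right, conjSignAction_apply]
  rcases Int.units_eq_one_or ((signedLift cs x).left t) with hx | hx <;>
    rcases Int.units_eq_one_or ((signedLift cs y).left (x⁻¹ * t * x)) with hy | hy <;>
    simp [hx, hy]

theorem mem_inversionSet_inv {x t : W} :
    t ∈ inversionSet cs x⁻¹ ↔ x * t * x⁻¹ ∈ inversionSet cs x := by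
  have h : ¬ Xor (t ∈ inversionSet cs x⁻¹) (x * t * x⁻¹ ∈ inversionSet cs x) := by
    simpa [inversionSet_one] using (mem_inversionSet_mul cs (x := x⁻¹) (y := x) (t := t)).not
  exact (not_xor _ _).mp h

/-- Dyer's canonical generators of a subgroup `G`, usually denoted `χ(G)`: the reflections whose
only inversion in `G` is themselves. -/
def canonicalGenerators (G : Subgroup W) : Set W :=
  {r | cs.IsReflection r ∧ inversionSet cs r ∩ G = {r}}

theorem simple_mem_canonicalGenerators_top (i : B) :
    cs.simple i ∈ canonicalGenerators cs ⊤ :=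
  ⟨cs.isReflection_simple i, by rw [inversionSet_simple, Subgroup.coe_top, Set.inter_univ]⟩

variable {cs} {G : Subgroup W}

theorem mem_inversionSet_canonicalGenerator_iff {r t : W} (hr : r ∈ canonicalGenerators cs G)
    (ht : t ∈ G) : t ∈ inversionSet cs r ↔ t = r := by
  simpa [ht] using Set.ext_iff.mp hr.2 t

theorem canonicalGenerators_subset : canonicalGenerators cs G ⊆ G := fun _ hr ↦
  Set.inter_subset_right (hr.2.ge rfl)

theorem exists_exchange_of_mem_inversionSet {L : List W}
    (hL : ∀ r ∈ L, r ∈ canonicalGenerators cs G) {t : W} (ht : t ∈ G)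
    (htL : t ∈ inversionSet cs L.prod) :
    ∃ a s b, L = a ++ s :: b ∧ t * L.prod = (a ++ b).prod := by
  induction L generalizing t with
  | nil => simp [inversionSet_one] at htL
  | cons r L ih =>
    obtain ⟨hr, hL⟩ := List.forall_mem_cons.mp hL
    have hrG : r ∈ G := canonicalGenerators_subset hr
    by_cases htr : t = r
    · exact ⟨[], r, L, rfl, by simp [htr, ← mul_assoc, hr.1.mul_self]⟩
    · rw [List.prod_cons, mem_inversionSet_mul, mem_inversionSet_canonicalGenerator_iff hr ht,
        eq_false htr, xor_false, id] at htL
      obtain ⟨a, s, b, rfl, hprod⟩ := ih hL (mul_mem (mul_mem (inv_mem hrG) ht) hrG) htL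
      refine ⟨r :: a, s, b, rfl, ?_⟩
      rw [List.cons_append, List.prod_cons, List.prod_cons, ← hprod]
      group

theorem exists_deletion_of_disjoint_inversionSet {r : W} {L : List W}
    (hr : r ∈ canonicalGenerators cs G) (hL : ∀ x ∈ L, x ∈ canonicalGenerators cs G)
    (hdisj : Disjoint (inversionSet cs (r :: L).prod) G) :
    ∃ a s b, L = a ++ s :: b ∧ (r :: L).prod = (a ++ b).prod := by
  have hrG : r ∈ G := canonicalGenerators_subset hr
  have hrL : r ∈ inversionSet cs L.prod := by
    have hnot : r ∉ inversionSet cs (r * L.prod) := fun h ↦ Set.disjoint_left.mp hdisj h hrG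
    simpa [mem_inversionSet_mul, mem_inversionSet_canonicalGenerator_iff hr hrG] using hnot
  exact exists_exchange_of_mem_inversionSet hL hrG hrL

theorem prod_eq_one_of_disjoint_inversionSet (L : List W)
    (hL : ∀ r ∈ L, r ∈ canonicalGenerators cs G) (hdisj : Disjoint (inversionSet cs L.prod) G) :
    L.prod = 1 := by
  match L with
  | [] => rfl
  | r :: L =>
    obtain ⟨hr, hL⟩ := List.forall_mem_cons.mp hL
    obtain ⟨a, s, b, rfl, hprod⟩ := exists_deletion_of_disjoint_inversionSet hr hL hdisj
    have hsub : a ++ b ⊆ a ++ s :: b := ((List.sublist_cons_self s b).append_left a).subset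
    rw [hprod] at hdisj ⊢
    exact prod_eq_one_of_disjoint_inversionSet (a ++ b) (fun x hx ↦ hL x (hsub hx)) hdisj
  termination_by L.length
  decreasing_by simp_all

theorem eq_nil_of_nodup_canonicalGenerators_of_prod_eq_one (L : List W)
    (hL : ∀ r ∈ L, r ∈ canonicalGenerators cs G) (hnodup : L.Nodup) (hprod : L.prod = 1) :
    L = [] := by
  match L with
  | [] => rfl
  | r :: L =>
    exfalso
    obtain ⟨hr, hL⟩ := List.forall_mem_cons.mp hL
    obtain ⟨hrL, hnodup⟩ := List.nodup_cons.mp hnodup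
    obtain ⟨a, s, b, rfl, hdel⟩ := exists_deletion_of_disjoint_inversionSet hr hL <| by
      rw [hprod, inversionSet_one]; exact Set.empty_disjoint _
    have hsub : (a ++ b).Sublist (a ++ s :: b) := (List.sublist_cons_self s b).append_left a
    have hnil : a ++ b = [] := eq_nil_of_nodup_canonicalGenerators_of_prod_eq_one (a ++ b)
      (fun x hx ↦ hL x (hsub.subset hx)) (hnodup.sublist hsub) (hdel ▸ hprod)
    obtain ⟨rfl, rfl⟩ := List.append_eq_nil_iff.mp hnil
    have hrs : r * s = 1 := by simpa using hprod
    have hss : s * s = 1 := (hL s (by simp)).1.mul_self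
    exact hrL (by simp [mul_right_cancel (hrs.trans hss.symm)])
  termination_by L.length
  decreasing_by simp_all

theorem conj_simple_mem_canonicalGenerators {x : W} (hx : Disjoint (inversionSet cs x) G) {i : B}
    (hr : x * cs.simple i * x⁻¹ ∈ G) : x * cs.simple i * x⁻¹ ∈ canonicalGenerators cs G := by
  refine ⟨⟨x, i, rfl⟩, Set.ext fun t ↦ ?_⟩
  rw [Set.mem_inter_iff, Set.mem_singleton_iff]
  suffices h : ∀ t ∈ G, t ∈ inversionSet cs (x * cs.simple i * x⁻¹) ↔ t = x * cs.simple i * x⁻¹ from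
    ⟨fun ht ↦ (h t ht.2).mp ht.1, fun ht ↦ ⟨(h t (ht ▸ hr)).mpr ht, ht ▸ hr⟩⟩
  intro t ht
  have htx : t ∉ inversionSet cs x := fun h ↦ Set.disjoint_left.mp hx h ht
  have htr : x * ((x * cs.simple i)⁻¹ * t * (x * cs.simple i)) * x⁻¹ ∉ inversionSet cs x := by
    have hconj : x * ((x * cs.simple i)⁻¹ * t * (x * cs.simple i)) * x⁻¹ =
        (x * cs.simple i * x⁻¹)⁻¹ * t * (x * cs.simple i * x⁻¹) := by group
    rw [hconj]
    exact fun h ↦ Set.disjoint_left.mp hx h (mul_mem (mul_mem (inv_mem hr) ht) hr)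
  calc
    t ∈ inversionSet cs (x * cs.simple i * x⁻¹) ↔ t ∈ inversionSet cs (x * cs.simple i) := by
      rw [mem_inversionSet_mul, mem_inversionSet_inv, eq_false htr, xor_comm, xor_false, id]
    _ ↔ x⁻¹ * t * x ∈ inversionSet cs (cs.simple i) := by
      rw [mem_inversionSet_mul, eq_false htx, xor_false, id]
    _ ↔ t = x * cs.simple i * x⁻¹ := by
      rw [inversionSet_simple, Set.mem_singleton_iff, eq_mul_inv_iff_mul_eq, mul_assoc,
        inv_mul_eq_iff_eq_mul]

variable (cs G) in
theorem exists_eq_closure_mul_disjoint_inversionSet (w : W) :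
    ∃ g ∈ Subgroup.closure (canonicalGenerators cs G), ∃ x, Disjoint (inversionSet cs x) G ∧
      w = g * x := by
  induction w using cs.simple_induction_right with
  | one => exact ⟨1, one_mem _, 1, by simp [inversionSet_one], by simp⟩
  | mul_simple_right w i ih =>
    obtain ⟨g, hg, x, hx, rfl⟩ := ih
    by_cases hr : x * cs.simple i * x⁻¹ ∈ G
    · have hmem := Subgroup.subset_closure (conj_simple_mem_canonicalGenerators hx hr)
      exact ⟨g * (x * cs.simple i * x⁻¹), mul_mem hg hmem, x, hx, by group⟩
    · refine ⟨g, hg, x * cs.simple i, Set.disjoint_left.mpr fun t htN htG ↦ hr ?_, by group⟩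
      have htx : t ∉ inversionSet cs x := fun h ↦ Set.disjoint_left.mp hx h htG
      have hconj : x⁻¹ * t * x = cs.simple i := by
        simpa [mem_inversionSet_mul, inversionSet_simple, htx] using htN
      have heq : t = x * cs.simple i * x⁻¹ := by rw [← hconj]; group
      exact heq ▸ htG

theorem closure_canonicalGenerators (hG : cs.IsReflectionSubgroup G) :
    Subgroup.closure (canonicalGenerators cs G) = G := by
  have hle : Subgroup.closure (canonicalGenerators cs G) ≤ G :=
    (Subgroup.closure_le G).mpr canonicalGenerators_subset
  refine hle.antisymm ?_
  obtain ⟨T, hT, hGT⟩ := hG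
  conv_lhs => rw [hGT]
  refine (Subgroup.closure_le _).mpr fun t ht ↦ ?_
  obtain ⟨u, i, htu⟩ := hT t ht
  obtain ⟨g, hg, x, hx, rfl⟩ := exists_eq_closure_mul_disjoint_inversionSet cs G u
  have htg : t = g * (x * cs.simple i * x⁻¹) * g⁻¹ := by rw [htu]; group
  have hr : x * cs.simple i * x⁻¹ ∈ G := by
    have htG : t ∈ G := hGT ▸ Subgroup.subset_closure ht
    rwa [htg, G.mul_mem_cancel_right (inv_mem (hle hg)), G.mul_mem_cancel_left (hle hg)] at htG
  rw [htg]
  exact mul_mem (mul_mem hg (Subgroup.subset_closure (conj_simple_mem_canonicalGenerators hx hr)))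
    (inv_mem hg)

theorem exists_list_canonicalGenerators_prod_eq (hG : cs.IsReflectionSubgroup G) {g : W}
    (hg : g ∈ G) :
    ∃ L : List W, (∀ r ∈ L, r ∈ canonicalGenerators cs G) ∧ L.prod = g := by
  rw [← closure_canonicalGenerators hG, ← Subgroup.mem_toSubmonoid,
    Subgroup.closure_toSubmonoid] at hg
  obtain ⟨L, hL, hprod⟩ := Submonoid.exists_list_of_mem_closure hg
  refine ⟨L, fun r hr ↦ (hL r hr).elim id fun hinv ↦ ?_, hprod⟩
  have hrinv : r⁻¹ ∈ canonicalGenerators cs G := hinv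
  rwa [← hrinv.1.inv, inv_inv] at hrinv

theorem exists_mem_inversionSet_of_ne_one (hG : cs.IsReflectionSubgroup G) {g : W} (hg : g ∈ G)
    (hne : g ≠ 1) : ∃ t ∈ inversionSet cs g, t ∈ G := by
  obtain ⟨L, hL, rfl⟩ := exists_list_canonicalGenerators_prod_eq hG hg
  exact Set.not_disjoint_iff.mp (mt (prod_eq_one_of_disjoint_inversionSet L hL) hne)

theorem mem_of_nodup_canonicalGenerators_of_prod_mem {H : Subgroup W}
    (hG : cs.IsReflectionSubgroup G) (hGH : G ≤ H) (L : List W)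
    (hL : ∀ r ∈ L, r ∈ canonicalGenerators cs H) (hnodup : L.Nodup) (hprod : L.prod ∈ G) :
    ∀ r ∈ L, r ∈ G := by
  by_cases hone : L.prod = 1
  · simp [eq_nil_of_nodup_canonicalGenerators_of_prod_eq_one L hL hnodup hone]
  obtain ⟨t, htN, htG⟩ := exists_mem_inversionSet_of_ne_one hG hprod hone
  obtain ⟨a, s, b, rfl, hex⟩ := exists_exchange_of_mem_inversionSet hL (hGH htG) htN
  have hsub : (a ++ b).Sublist (a ++ s :: b) := (List.sublist_cons_self s b).append_left a
  have hab : ∀ r ∈ a ++ b, r ∈ G := mem_of_nodup_canonicalGenerators_of_prod_mem hG hGH (a ++ b)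
    (fun x hx ↦ hL x (hsub.subset hx)) (hnodup.sublist hsub) (hex ▸ mul_mem htG hprod)
  obtain ⟨ha, hb⟩ := List.forall_mem_append.mp hab
  have hs : s ∈ G := by
    rwa [List.prod_append, List.prod_cons, G.mul_mem_cancel_left (list_prod_mem ha),
      G.mul_mem_cancel_right (list_prod_mem hb)] at hprod
  exact List.forall_mem_append.mpr ⟨ha, List.forall_mem_cons.mpr ⟨hs, hb⟩⟩
  termination_by L.length
  decreasing_by simp_all

end InversionSet

theorem mainTheorem12_general {B W : Type*} [Group W] {M : CoxeterMatrix B}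
    (cs : CoxeterSystem M W) (H : Subgroup W) (J : Set W) (hJ : J ⊆ canonicalGenerators cs H)
    (l : List W) (hl : l.Nodup) (hlJ : ∀ x, x ∈ l ↔ x ∈ J) :
    (∀ G : Subgroup W, cs.IsReflectionSubgroup G → G ≤ H → l.prod ∈ G → J ⊆ (G : Set W)) ∧
    (∀ K : Subgroup W,
      Minimal (fun G : Subgroup W ↦ cs.IsReflectionSubgroup G ∧ G ≤ H ∧ l.prod ∈ G) K ↔
        K = Subgroup.closure J) := by
  have hsub (G : Subgroup W) (hG : cs.IsReflectionSubgroup G) (hGH : G ≤ H) (hprod : l.prod ∈ G) :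
      J ⊆ G := fun x hx ↦
    mem_of_nodup_canonicalGenerators_of_prod_mem hG hGH l (fun r hr ↦ hJ ((hlJ r).mp hr)) hl hprod
      x ((hlJ x).mpr hx)
  have hclosure : cs.IsReflectionSubgroup (Subgroup.closure J) := ⟨J, fun r hr ↦ (hJ hr).1, rfl⟩
  have hle : Subgroup.closure J ≤ H :=
    (Subgroup.closure_le H).mpr (hJ.trans canonicalGenerators_subset)
  have hprod : l.prod ∈ Subgroup.closure J :=
    list_prod_mem fun x hx ↦ Subgroup.subset_closure ((hlJ x).mp hx)
  have hleast : IsLeast {G | cs.IsReflectionSubgroup G ∧ G ≤ H ∧ l.prod ∈ G}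
      (Subgroup.closure J) :=
    ⟨⟨hclosure, hle, hprod⟩, fun G ⟨hG, hGH, hG_prod⟩ ↦
      (Subgroup.closure_le G).mpr (hsub G hG hGH hG_prod)⟩
  exact ⟨hsub, fun K ↦ hleast.minimal_iff⟩

/-- `S` is `Set.range cs.simple`, the list `l` is an arbitrary ordering of the elements of `J`
without repetition, `w` is `l.prod`, and `W_J` is `Subgroup.closure J`. -/
theorem mainTheorem12 {B W : Type*} [Group W] {M : CoxeterMatrix B} (cs : CoxeterSystem M W)
    (J : Set W) (hJ : J ⊆ Set.range cs.simple)
    (l : List W) (hl : l.Nodup) (hlJ : ∀ x, x ∈ l ↔ x ∈ J) :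
    (∀ G : Subgroup W, cs.IsReflectionSubgroup G → l.prod ∈ G → J ⊆ (G : Set W)) ∧
    (∀ H : Subgroup W,
      Minimal (fun G : Subgroup W => cs.IsReflectionSubgroup G ∧ l.prod ∈ G) H ↔
        H = Subgroup.closure J) := by
  simpa only [le_top, true_and, true_implies] using mainTheorem12_general cs ⊤ J
    (hJ.trans (Set.range_subset_iff.mpr (simple_mem_canonicalGenerators_top cs))) l hl hlJ
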